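/- Fix a privacy level $\epsilon>0$, a quantile level $\alpha\in(0,1)$, a scale $\sigma>0$, real numbers $l<u$, and a dimension $d$. **Protocol.** For $i=1,2,\dots$, independently, the public covariate $X_i$ is uniform on $[-1,1]^d$. Given $X_i=x$, the answer $Y_i\in\mathbb R$ has an unknown conditional law $F(\cdot\mid x)$. The user truncates $Y_i$ to $t(Y_i)=\max(l,\min(Y_i,u))$ and releases one bit $Z_i\in\{0,1\}$ with $\Pr(Z_i=z\mid X_i,Y_i)=\mathrm{bf}(z\mid t(Y_i))$, where $$\mathrm{bf}(1\mid v)=\frac12+\frac{v-\frac{u+l}{2}}{(u-l)C_\epsilon},\qquad \mathrm{bf}(0\mid v)=1-\mathrm{bf}(1\mid v),\qquad C_\epsilon=\frac{e^\epsilon+1}{e^\epsilon-1}.$$ Let $P$ be the joint law of $(X_i,Z_i)$. **Model.** Let $\mathcal B\subset\mathbb R^d$ be compact. For $\beta\in\mathbb R^d$ let $F_\beta(\cdot\mid x)$ be the asymmetric Laplace law with Lebesgue density $$f_\beta(y\mid x)=\frac{\alpha(1-\alpha)}{\sigma}\exp\Big(-\rho_\alpha\Big(\frac{y-\langle\beta,x\rangle}{\sigma}\Big)\Big),\qquad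 \rho_\alpha(\tau)=\begin{cases}(\alpha-1)\tau,&\tau\le0,\\ \alpha\tau,&\tau>0,\end{cases}$$ and put $p_\beta(x,z)=f_X(x)\int \mathrm{bf}(z\mid t(y))\,dF_\beta(y\mid x)$, where $f_X=2^{-d}\mathbf 1_{[-1,1]^d}$. Let $\hat\beta_n$ be any (measurable) maximizer over $\beta\in\mathcal B$ of $\frac1n\sum_{i=1}^n\log p_\beta(X_i,Z_i)$. Write $$A(\beta)=P\,\frac{\partial^2\log p_\beta}{\partial\beta^2},\qquad B(\beta)=P\Big(\frac{\partial\log p_\beta}{\partial\beta}\Big)\Big(\frac{\partial\log p_\beta}{\partial\beta}\Big)^{\top},\qquad C(\beta)=A(\beta)^{-1}B(\beta)A(\beta)^{-1}.$$ **Claim.** Suppose that $F(\cdot\mid x)$ has, for every $x\in[-1,1]^d$, a density $f(y\mid x)$ with respect to a fixed measure $\nu$ on $\mathbb R$ that is measurable in $y$; that $\beta\mapsto P\log p_\beta$ has a unique maximizer $\beta^*$ over $\mathcal B$; and that $\beta^*$ is interior to $\mathcal B$. Then $\hat\beta_n\to\beta^*$ almost surely. If moreover $\beta^*$ is a nondegenerate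 maximum, that is, $A(\beta^*)$ is nonsingular (so that $C(\beta^*)$ is defined), then $$\sqrt n\,(\hat\beta_n-\beta^*)\to\mathcal N(0_d,C(\beta^*))\quad\text{in distribution.}$$ -/

import Mathlib

open MeasureTheory ProbabilityTheory Filter Topology Set
open scoped ENNReal Matrix

noncomputable section

namespace LDPQuantile

/-- The constants of the survey: privacy level `ε > 0`, quantile level `α ∈ (0, 1)`, scale `σ > 0`
of the asymmetric Laplace model, and truncation interval `[lo, hi]` with `lo < hi`. -/
structure Survey where
  ε : ℝ
  α : ℝ
  σ : ℝ
  lo : ℝ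
  hi : ℝ
  ε_pos : 0 < ε
  α_pos : 0 < α
  α_lt_one : α < 1
  σ_pos : 0 < σ
  lo_lt_hi : lo < hi

/-! ### The one-bit privatization mechanism -/

/-- `C_ε = (e^ε + 1) / (e^ε - 1)`. -/
def flipConst (ε : ℝ) : ℝ := (Real.exp ε + 1) / (Real.exp ε - 1)

/-- The bit flip: the probability of releasing the bit `z` on input `v ∈ [lo, hi]`, where `true`
stands for `z = 1` and `false` for `z = 0`. -/
def bitFlip (m : Survey) (z : Bool) (v : ℝ) : ℝ :=
  if z = true then 1 / 2 + (v - (m.hi + m.lo) / 2) / ((m.hi - m.lo) * flipConst m.ε)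
  else 1 / 2 - (v - (m.hi + m.lo) / 2) / ((m.hi - m.lo) * flipConst m.ε)

/-- Truncation of a real number into `[lo, hi]`. -/
def truncate (m : Survey) (y : ℝ) : ℝ := max m.lo (min y m.hi)

lemma measurable_bitFlip_truncate (m : Survey) (z : Bool) :
    Measurable fun y => bitFlip m z (truncate m y) := by
  cases z <;> simp only [bitFlip, truncate] <;> simp <;> fun_prop

/-- What a user does with her answer `y`: truncate it, then apply the bit flip. -/
def releaseKernel (m : Survey) : Kernel ℝ Bool where
  toFun y := ∑ z : Bool, ENNReal.ofReal (bitFlip m z (truncate m y)) • Measure.dirac z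
  measurable' := by
    refine Measure.measurable_of_measurable_coe _ fun s _ => ?_
    simp only [Measure.coe_finsetSum, Finset.sum_apply, Measure.smul_apply, smul_eq_mul]
    exact Finset.measurable_sum _ fun z _ =>
      ((measurable_bitFlip_truncate m z).ennreal_ofReal).mul_const _

/-- The probability `∫ bitFlip(z | t(y)) dμ(y)` that a user whose answer has law `μ` releases
the bit `z`. -/
def releaseProb (m : Survey) (μ : Measure ℝ) (z : Bool) : ℝ :=
  ∫ y, bitFlip m z (truncate m y) ∂μ

/-! ### The design and the data -/

/-- The cube `[-1, 1]^d`. -/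
def cube (d : ℕ) : Set (EuclideanSpace ℝ (Fin d)) := {x | ∀ j, x j ∈ Icc (-1 : ℝ) 1}

/-- The law of the public covariates: the product of `d` uniform laws on `[-1, 1]`. -/
def designLaw (d : ℕ) : Measure (EuclideanSpace ℝ (Fin d)) :=
  (Measure.pi fun _ : Fin d => cond (volume : Measure ℝ) (Icc (-1) 1)).map (WithLp.toLp 2)

open Classical in
/-- The Lebesgue density of `designLaw d`. -/
def designDensity (d : ℕ) (x : EuclideanSpace ℝ (Fin d)) : ℝ :=
  if x ∈ cube d then (1 / 2) ^ d else 0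

/-- The law of `((X, Y), Z)` for one user: `X` has law `designLaw d`, given `X = x` the answer `Y`
has law `κ x`, and given `Y = y` the released bit `Z` has law `releaseKernel m y`. -/
def userLaw (m : Survey) {d : ℕ} (κ : Kernel (EuclideanSpace ℝ (Fin d)) ℝ) :
    Measure ((EuclideanSpace ℝ (Fin d) × ℝ) × Bool) :=
  (designLaw d ⊗ₘ κ) ⊗ₘ (releaseKernel m).comap Prod.snd measurable_snd

/-- The joint law `P` of `(X, Z)`, the part of a record that the curator sees. -/
def observedLaw (m : Survey) {d : ℕ} (κ : Kernel (EuclideanSpace ℝ (Fin d)) ℝ) :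
    Measure (EuclideanSpace ℝ (Fin d) × Bool) :=
  (userLaw m κ).map fun w => (w.1.1, w.2)

/-! ### The asymmetric Laplace regression model -/

/-- The check loss. -/
def checkLoss (α τ : ℝ) : ℝ := if τ ≤ 0 then (α - 1) * τ else α * τ

/-- The asymmetric Laplace density with location `μ`. -/
def asymLaplaceDensity (m : Survey) (μ y : ℝ) : ℝ :=
  m.α * (1 - m.α) / m.σ * Real.exp (-checkLoss m.α ((y - μ) / m.σ))

/-- The model law `F_β(· | x)`: asymmetric Laplace with location `⟨β, x⟩`. -/
def modelLaw (m : Survey) {d : ℕ} (β x : EuclideanSpace ℝ (Fin d)) : Measure ℝ :=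
  (volume : Measure ℝ).withDensity fun y => ENNReal.ofReal (asymLaplaceDensity m (inner ℝ β x) y)

/-- `log p_β(x, z)`, where `p_β(x, z) = p_β(z | x) f_X(x)` is the model density of `(X, Z)` with
respect to Lebesgue measure times counting measure. -/
def logDensity (m : Survey) {d : ℕ} (β : EuclideanSpace ℝ (Fin d))
    (w : EuclideanSpace ℝ (Fin d) × Bool) : ℝ :=
  Real.log (releaseProb m (modelLaw m β w.1) w.2 * designDensity d w.1)

/-- The normalized log-likelihood of the first `n` observations. -/
def logLikelihood (m : Survey) {d : ℕ} (n : ℕ) (D : ℕ → EuclideanSpace ℝ (Fin d) × Bool)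
    (β : EuclideanSpace ℝ (Fin d)) : ℝ :=
  (1 / (n : ℝ)) * ∑ i ∈ Finset.range n, logDensity m β (D i)

/-- The population objective `P log p_β`. -/
def expectedLogDensity (m : Survey) {d : ℕ} (κ : Kernel (EuclideanSpace ℝ (Fin d)) ℝ)
    (β : EuclideanSpace ℝ (Fin d)) : ℝ :=
  ∫ w, logDensity m β w ∂(observedLaw m κ)

/-! ### The asymptotic covariance -/

/-- The `j`-th partial derivative. -/
def partialDeriv {d : ℕ} (j : Fin d) (g : EuclideanSpace ℝ (Fin d) → ℝ)
    (β : EuclideanSpace ℝ (Fin d)) : ℝ :=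
  lineDeriv ℝ g β (EuclideanSpace.single j 1)

/-- `A(β) = P ∂² log p_β / ∂β²`. -/
def hessianMatrix (m : Survey) {d : ℕ} (κ : Kernel (EuclideanSpace ℝ (Fin d)) ℝ)
    (β : EuclideanSpace ℝ (Fin d)) : Matrix (Fin d) (Fin d) ℝ :=
  Matrix.of fun i j =>
    ∫ w, partialDeriv i (partialDeriv j fun b => logDensity m b w) β ∂(observedLaw m κ)

/-- `B(β) = P (∂ log p_β / ∂β) (∂ log p_β / ∂β)ᵀ`. -/
def scoreMatrix (m : Survey) {d : ℕ} (κ : Kernel (EuclideanSpace ℝ (Fin d)) ℝ)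
    (β : EuclideanSpace ℝ (Fin d)) : Matrix (Fin d) (Fin d) ℝ :=
  Matrix.of fun i j =>
    ∫ w, partialDeriv i (fun b => logDensity m b w) β *
      partialDeriv j (fun b => logDensity m b w) β ∂(observedLaw m κ)

/-- `C(β) = A(β)⁻¹ B(β) A(β)⁻¹`. -/
def asymptoticCov (m : Survey) {d : ℕ} (κ : Kernel (EuclideanSpace ℝ (Fin d)) ℝ)
    (β : EuclideanSpace ℝ (Fin d)) : Matrix (Fin d) (Fin d) ℝ :=
  (hessianMatrix m κ β)⁻¹ * scoreMatrix m κ β * (hessianMatrix m κ β)⁻¹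

end LDPQuantile

end

/-!
The estimator maximizes an average of `log p_β(X_i, Z_i)`, and the theorem is the classical one for
M-estimators with a smooth criterion. What has to be seen is that the criterion is as smooth as one
could wish, uniformly in the data, although the asymmetric Laplace density has a kink.

*The model.* `p_β(z | x)` depends on `β` through `θ = ⟨β, x⟩` only, and equals
`Φ_z(θ) = ∫ bitFlip z (truncate (θ + u)) k(u) du`, where `k` is the noise density
(`releaseProb_modelLaw`). The truncated bit flip is affine on `[lo, hi]` and constant outside, so
`Φ_z'(θ)` is a multiple of `∫ k` over `[lo - θ, hi - θ]` and `Φ_z''(θ)` is a multiple of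
`k(lo - θ) - k(hi - θ)` (`hasDerivAt_responseProb`, `hasDerivAt_responseProbDeriv`). Since `k` is
bounded and Lipschitz, so is `Φ_z''`. Privatization keeps `Φ_z` away from zero
(`exists_le_responseProb_le`), hence the first two derivatives of `log Φ_z` are bounded and
Lipschitz. The covariates being bounded, `log p_β` has a bounded gradient (the score) and a bounded
Lipschitz Hessian in `β`, uniformly in the observation: `exists_isSmoothCriterion_logDensity`.

*Consistency.* The empirical criteria are equi-Lipschitz, so the strong law of large numbers on a
countable dense set gives almost sure convergence at every parameter, and limit points of maximizers
over the compact parameter set maximize the population criterion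
(`IsSmoothCriterion.ae_tendsto_argmax`).

*Asymptotic normality.* Once the estimator is interior, its scores sum to zero. With `T_n` and `A_n`
the average score and Hessian at `βs`, a Taylor expansion gives
`T_n + A_n (βhat_n - βs) = O(‖βhat_n - βs‖²)`, and `A_n → A` almost surely. Hence
`√n (βhat_n - βs)` differs from `U_n = -A⁻¹ √n T_n` by `o(‖U_n‖)`. The score has mean zero at the
interior maximizer `βs`, so `U_n` converges to `N(0, A⁻¹ B A⁻¹)` by the multivariate central limit
theorem, and the relative error is absorbed by a form of Slutsky's theorem
(`IsSmoothCriterion.tendstoInDistribution_argmax`, `tendstoInDistribution_of_norm_sub_le`).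
-/

namespace LDPQuantile

/-! ### Convergence in distribution -/

section Probability

variable {Ω : Type*} [MeasurableSpace Ω] {P : Measure Ω} [IsProbabilityMeasure P]

/-- The multivariate central limit theorem, reduced by characteristic functions to the
one-dimensional one for the projections `⟪V i, t⟫`. -/
theorem tendstoInDistribution_inv_sqrt_smul_sum {d : ℕ} {V : ℕ → Ω → EuclideanSpace ℝ (Fin d)}
    (hindep : iIndepFun V P) (hident : ∀ i, IdentDistrib (V i) (V 0) P P)
    (hL2 : MemLp (V 0) 2 P) (hmean : ∀ t, ∫ ω, inner ℝ (V 0 ω) t ∂P = 0)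
    {S : Matrix (Fin d) (Fin d) ℝ} (hS : S.PosSemidef)
    (hcov : ∀ t : EuclideanSpace ℝ (Fin d), ∫ ω, inner ℝ (V 0 ω) t ^ 2 ∂P = t ⬝ᵥ S *ᵥ t) :
    TendstoInDistribution (fun (n : ℕ) ω => (√(n : ℝ))⁻¹ • ∑ i ∈ Finset.range n, V i ω) atTop id
      (fun _ => P) (multivariateGaussian 0 S) := by
  have hV (i : ℕ) : AEMeasurable (V i) P := (hident i).aemeasurable_fst
  have hsum (n : ℕ) : AEMeasurable (fun ω => (√(n : ℝ))⁻¹ • ∑ i ∈ Finset.range n, V i ω) P :=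
    (Finset.aemeasurable_fun_sum _ fun i _ => hV i).fun_const_smul _
  refine ⟨hsum, aemeasurable_id, ?_⟩
  refine ProbabilityMeasure.tendsto_iff_tendsto_charFun.2 fun t => ?_
  have hproj : Measurable fun x : EuclideanSpace ℝ (Fin d) => (inner ℝ x t : ℝ) := by fun_prop
  have hproj_mem : MemLp (fun ω => (inner ℝ (V 0 ω) t : ℝ)) 2 P := hL2.inner_const t
  have hvar : Var[fun ω => (inner ℝ (V 0 ω) t : ℝ); P] = t ⬝ᵥ S *ᵥ t := by
    rw [variance_of_integral_eq_zero hproj_mem.aestronglyMeasurable.aemeasurable (hmean t),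
      ← hcov t]
  have hclt := tendstoInDistribution_inv_sqrt_mul_sum_sub (P := P)
    (X := fun i ω => (inner ℝ (V i ω) t : ℝ)) (P' := gaussianReal 0 _) (HasLaw.id) hproj_mem
    (hindep.comp (fun _ x => (inner ℝ x t : ℝ)) fun _ => hproj)
    (fun i => (hident i).comp hproj)
  have hchar := ProbabilityMeasure.tendsto_iff_tendsto_charFun.1 hclt.tendsto 1
  simp only [ProbabilityMeasure.coe_mk, Measure.map_id, hvar, hmean t, charFun_gaussianReal,
    mul_zero, sub_zero] at hchar ⊢
  rw [charFun_multivariateGaussian hS]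
  have hnn : 0 ≤ t ⬝ᵥ S *ᵥ t := by rw [← hcov t]; positivity
  convert hchar using 2 with n
  · rw [charFun_apply, charFun_apply,
      integral_map (hsum n) (Measurable.aestronglyMeasurable (by fun_prop)),
      integral_map ?_ (Measurable.aestronglyMeasurable (by fun_prop))]
    · refine integral_congr_ae (ae_of_all _ fun ω => ?_)
      simp [real_inner_smul_left, sum_inner]
    · exact (Finset.aemeasurable_fun_sum _ fun i _ =>
        hproj.comp_aemeasurable (hV i)).const_mul _
  · simp [hnn]

/-- A relative form of Slutsky's theorem: a sequence whose distance to `U n` is eventually an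
`o(1)` multiple of `‖U n‖`, almost surely, has the same limit in distribution as `U n`. -/
theorem tendstoInDistribution_of_norm_sub_le {E : Type*} [NormedAddCommGroup E] [NormedSpace ℝ E]
    [MeasurableSpace E] [BorelSpace E] [SecondCountableTopology E]
    {Ω' : Type*} [MeasurableSpace Ω'] {P' : Measure Ω'} [IsProbabilityMeasure P']
    {U Y : ℕ → Ω → E} {Z : Ω' → E} (hU : TendstoInDistribution U atTop Z (fun _ => P) P')
    (hY : ∀ n, AEMeasurable (Y n) P)
    (hYU : ∀ᵐ ω ∂P, ∃ δ : ℕ → ℝ, Tendsto δ atTop (𝓝 0) ∧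
      ∀ᶠ n in atTop, ‖Y n ω - U n ω‖ ≤ δ n * ‖U n ω‖) :
    TendstoInDistribution Y atTop Z (fun _ => P) P' := by
  have hUm := hU.forall_aemeasurable
  -- the relative error, so that `Y n = U n + ‖U n‖ • D n` is a continuous function of `(U n, D n)`
  let D : ℕ → Ω → E := fun n ω => ‖U n ω‖⁻¹ • (Y n ω - U n ω)
  have hDm (n : ℕ) : AEMeasurable (D n) P := (hUm n).norm.inv.smul ((hY n).sub (hUm n))
  have hD0 : ∀ᵐ ω ∂P, Tendsto (fun n => D n ω) atTop (𝓝 0) := by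
    filter_upwards [hYU] with ω ⟨δ, hδ, hle⟩
    refine squeeze_zero_norm' ?_ (by simpa using hδ.abs)
    filter_upwards [hle] with n hn
    rcases eq_or_ne (U n ω) 0 with h0 | h0
    · simp [D, h0]
    · have hpos : 0 < ‖U n ω‖ := norm_pos_iff.2 h0
      rw [norm_smul, norm_inv, norm_norm, inv_mul_le_iff₀ hpos]
      exact hn.trans (by rw [mul_comm]; gcongr; exact le_abs_self _)
  have hmain := hU.continuous_comp_prodMk_of_tendstoInMeasure_const
    (g := fun p : E × E => p.1 + ‖p.1‖ • p.2) (by fun_prop)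
    (tendstoInMeasure_of_tendsto_ae (fun n => (hDm n).aestronglyMeasurable) hD0) hDm
  simp only [smul_zero, add_zero] at hmain
  refine tendstoInDistribution_of_tendstoInMeasure_sub Y Z hmain ?_ hY
  refine tendstoInMeasure_of_tendsto_ae
    (fun n => ((hY n).sub (hmain.forall_aemeasurable n)).aestronglyMeasurable) ?_
  filter_upwards [hYU] with ω ⟨δ, _, hle⟩
  refine tendsto_const_nhds.congr' ?_
  filter_upwards [hle] with n hn
  rcases eq_or_ne (U n ω) 0 with h0 | h0
  · simp only [h0, norm_zero, mul_zero, norm_le_zero_iff, sub_zero] at hn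
    simp [h0, hn]
  · simp [D, h0, smul_smul]

end Probability

/-! ### Convergence of maximizers -/

section Convergence

variable {E : Type*} [PseudoMetricSpace E]

/-- For equi-Lipschitz functions, convergence on a dense set is convergence everywhere. -/
theorem tendsto_of_tendsto_dense_of_lipschitz {F : ℕ → E → ℝ} {G : E → ℝ} {L : ℝ} {t : Set E}
    (ht : Dense t) (hF : ∀ n x y, |F n x - F n y| ≤ L * dist x y)
    (hG : ∀ x y, |G x - G y| ≤ L * dist x y)
    (hlim : ∀ x ∈ t, Tendsto (fun n => F n x) atTop (𝓝 (G x))) (x : E) :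
    Tendsto (fun n => F n x) atTop (𝓝 (G x)) := by
  rw [Metric.tendsto_atTop]
  intro ε hε
  obtain ⟨y, hy, hxy⟩ := ht.exists_dist_lt x (ε := ε / (3 * (|L| + 1))) (by positivity)
  have hsmall : L * dist x y < ε / 3 := by
    calc L * dist x y ≤ (|L| + 1) * dist x y := by
          gcongr; linarith [le_abs_self L]
      _ < (|L| + 1) * (ε / (3 * (|L| + 1))) := by gcongr
      _ = ε / 3 := by field_simp
  obtain ⟨N, hN⟩ := Metric.tendsto_atTop.1 (hlim y hy) (ε / 3) (by positivity)
  refine ⟨N, fun n hn => ?_⟩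
  have h1 := abs_le.1 (hF n x y)
  have h2 := abs_le.1 (hG x y)
  have h3 := abs_lt.1 (hN n hn)
  rw [Real.dist_eq, abs_lt]
  constructor <;> linarith

/-- Maximizers over a compact set of equi-Lipschitz functions converge to the unique maximizer
of the pointwise limit. -/
theorem tendsto_argmax_of_lipschitz {F : ℕ → E → ℝ} {G : E → ℝ} {L : ℝ} {K : Set E}
    (hK : IsCompact K) (hF : ∀ n x y, |F n x - F n y| ≤ L * dist x y)
    (hlim : ∀ x, Tendsto (fun n => F n x) atTop (𝓝 (G x))) {x₀ : E}
    (huniq : ∀ x ∈ K, IsMaxOn G K x → x = x₀) {x : ℕ → E} (hxK : ∀ n, x n ∈ K)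
    (hmax : ∀ n, IsMaxOn (F n) K (x n)) : Tendsto x atTop (𝓝 x₀) := by
  refine tendsto_of_subseq_tendsto fun ns hns => ?_
  obtain ⟨a, haK, φ, hφ, ha⟩ := hK.tendsto_subseq fun n => hxK (ns n)
  have hseq : Tendsto (fun n => ns (φ n)) atTop atTop := hns.comp hφ.tendsto_atTop
  have hval : Tendsto (fun n => F (ns (φ n)) (x (ns (φ n)))) atTop (𝓝 (G a)) := by
    have hdiff : Tendsto (fun n => F (ns (φ n)) (x (ns (φ n))) - F (ns (φ n)) a) atTop (𝓝 0) := by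
      refine squeeze_zero_norm (fun n => hF _ _ _) ?_
      simpa using (tendsto_iff_dist_tendsto_zero.1 ha).const_mul L
    simpa using hdiff.add ((hlim a).comp hseq)
  have hamax : IsMaxOn G K a := fun y hy =>
    le_of_tendsto_of_tendsto' ((hlim y).comp hseq) hval fun n => hmax (ns (φ n)) hy
  exact ⟨φ, huniq a haK hamax ▸ ha⟩

end Convergence

/-! ### M-estimation with a smooth criterion -/

section MEstimation

variable {d : ℕ} {W : Type*} [MeasurableSpace W]

/-- A criterion `ℓ` on the parameter space with gradient `s` (the score) and Hessian `H`, both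
bounded by `L` and with `L`-Lipschitz Hessian, uniformly in the data point. -/
structure IsSmoothCriterion (μ : Measure W) (ℓ : EuclideanSpace ℝ (Fin d) → W → ℝ)
    (s : EuclideanSpace ℝ (Fin d) → W → EuclideanSpace ℝ (Fin d))
    (H : EuclideanSpace ℝ (Fin d) → W → EuclideanSpace ℝ (Fin d) →L[ℝ] EuclideanSpace ℝ (Fin d))
    (L : ℝ) : Prop where
  measurable_criterion : ∀ β, Measurable (ℓ β)
  measurable_score : ∀ β, Measurable (s β)
  stronglyMeasurable_hessian : ∀ β, StronglyMeasurable (H β)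
  integrable_criterion : ∀ β, Integrable (ℓ β) μ
  hasFDerivAt_criterion : ∀ β w, HasFDerivAt (fun b => ℓ b w) (innerSL ℝ (s β w)) β
  hasFDerivAt_score : ∀ β w, HasFDerivAt (fun b => s b w) (H β w) β
  norm_score_le : ∀ β w, ‖s β w‖ ≤ L
  norm_hessian_le : ∀ β w, ‖H β w‖ ≤ L
  norm_hessian_sub_le : ∀ β b w, ‖H b w - H β w‖ ≤ L * ‖b - β‖

/-- The strong law of large numbers for a function of i.i.d. data. -/
theorem ae_tendsto_average {F : Type*} [NormedAddCommGroup F] [NormedSpace ℝ F] [CompleteSpace F]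
    [MeasurableSpace F] [BorelSpace F] {μ : Measure W}
    {Ω : Type*} [MeasurableSpace Ω] {P : Measure Ω} {D : ℕ → Ω → W}
    (hlaw : ∀ i, HasLaw (D i) μ P) (hindep : iIndepFun D P) {g : W → F}
    (hg : StronglyMeasurable g) (hint : Integrable g μ) :
    ∀ᵐ ω ∂P, Tendsto (fun n : ℕ => (n : ℝ)⁻¹ • ∑ i ∈ Finset.range n, g (D i ω)) atTop
      (𝓝 (∫ w, g w ∂μ)) := by
  have h := strong_law_ae (μ := P) (fun i ω => g (D i ω))
    (by
      have h0 := hint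
      rw [← (hlaw 0).map_eq] at h0
      exact h0.comp_aemeasurable (hlaw 0).aemeasurable)
    (fun i j hij => (hindep.comp (fun _ => g) fun _ => hg.measurable).indepFun hij)
    (fun i => IdentDistrib.comp ⟨(hlaw i).aemeasurable, (hlaw 0).aemeasurable, by
      rw [(hlaw i).map_eq, (hlaw 0).map_eq]⟩ hg.measurable)
  rwa [← (hlaw 0).integral_comp hg.aestronglyMeasurable]

namespace IsSmoothCriterion

variable {μ : Measure W} {ℓ : EuclideanSpace ℝ (Fin d) → W → ℝ}
  {s : EuclideanSpace ℝ (Fin d) → W → EuclideanSpace ℝ (Fin d)}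
  {H : EuclideanSpace ℝ (Fin d) → W → EuclideanSpace ℝ (Fin d) →L[ℝ] EuclideanSpace ℝ (Fin d)}
  {L : ℝ}

theorem abs_criterion_sub_le (h : IsSmoothCriterion μ ℓ s H L) (w : W)
    (β b : EuclideanSpace ℝ (Fin d)) : |ℓ β w - ℓ b w| ≤ L * dist β b := by
  rw [dist_eq_norm]
  exact convex_univ.norm_image_sub_le_of_norm_hasFDerivWithin_le (𝕜 := ℝ)
    (fun x _ => (h.hasFDerivAt_criterion x w).hasFDerivWithinAt)
    (fun x _ => by simpa using h.norm_score_le x w) (mem_univ b) (mem_univ β)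

/-- First-order Taylor expansion of the score with a quadratic remainder. -/
theorem norm_score_sub_sub_le (h : IsSmoothCriterion μ ℓ s H L) (w : W)
    (β b : EuclideanSpace ℝ (Fin d)) :
    ‖s b w - s β w - H β w (b - β)‖ ≤ L * ‖b - β‖ * ‖b - β‖ := by
  have hL : 0 ≤ L := (norm_nonneg _).trans (h.norm_score_le β w)
  refine (convex_segment β b).norm_image_sub_le_of_norm_hasFDerivWithin_le' (𝕜 := ℝ)
    (fun x _ => (h.hasFDerivAt_score x w).hasFDerivWithinAt) (fun x hx => ?_)
    (left_mem_segment ℝ β b) (right_mem_segment ℝ β b)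
  refine (h.norm_hessian_sub_le β x w).trans ?_
  gcongr
  exact norm_sub_le_of_mem_segment hx

/-- The estimating equation: the scores sum to zero at an interior maximizer of the empirical
criterion. -/
theorem sum_score_eq_zero (h : IsSmoothCriterion μ ℓ s H L) {D : ℕ → W} {n : ℕ} (hn : n ≠ 0)
    {K : Set (EuclideanSpace ℝ (Fin d))} {β : EuclideanSpace ℝ (Fin d)} (hβ : β ∈ interior K)
    (hmax : IsMaxOn (fun b => (1 / (n : ℝ)) * ∑ i ∈ Finset.range n, ℓ b (D i)) K β) :
    ∑ i ∈ Finset.range n, s β (D i) = 0 := by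
  have hderiv : HasFDerivAt (fun b => (1 / (n : ℝ)) * ∑ i ∈ Finset.range n, ℓ b (D i))
      ((1 / (n : ℝ)) • ∑ i ∈ Finset.range n, innerSL ℝ (s β (D i))) β :=
    (HasFDerivAt.fun_sum fun i _ => h.hasFDerivAt_criterion β (D i)).const_mul _
  have h0 := (hmax.isLocalMax (mem_interior_iff_mem_nhds.1 hβ)).hasFDerivAt_eq_zero hderiv
  rw [← map_sum, smul_eq_zero] at h0
  have h1 := h0.resolve_left (by simpa using hn)
  rw [← norm_eq_zero, ← innerSL_apply_norm ℝ, h1, norm_zero]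

/-- The linearized estimating equation: with `A n` the average Hessian and `T n` the average score
at `β`, an interior empirical maximizer `b` satisfies `T n + A n (b - β) = O(‖b - β‖²)`. -/
theorem norm_average_score_add_le (h : IsSmoothCriterion μ ℓ s H L) {D : ℕ → W} {n : ℕ}
    (hn : n ≠ 0) {β b : EuclideanSpace ℝ (Fin d)}
    (hb : ∑ i ∈ Finset.range n, s b (D i) = 0) :
    ‖(n : ℝ)⁻¹ • ∑ i ∈ Finset.range n, s β (D i) +
      ((n : ℝ)⁻¹ • ∑ i ∈ Finset.range n, H β (D i)) (b - β)‖ ≤ L * ‖b - β‖ * ‖b - β‖ := by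
  have heq : (n : ℝ)⁻¹ • ∑ i ∈ Finset.range n, s β (D i) +
      ((n : ℝ)⁻¹ • ∑ i ∈ Finset.range n, H β (D i)) (b - β) =
      -((n : ℝ)⁻¹ • ∑ i ∈ Finset.range n, (s b (D i) - s β (D i) - H β (D i) (b - β))) := by
    rw [Finset.sum_sub_distrib, Finset.sum_sub_distrib, hb, smul_apply,
      sum_apply, ← smul_add, ← smul_neg]
    congr 1
    abel
  have hn' : (0 : ℝ) < n := by positivity
  rw [heq, norm_neg, norm_smul, norm_inv, Real.norm_natCast, inv_mul_le_iff₀ hn']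
  refine (norm_sum_le_of_le _ fun i _ => h.norm_score_sub_sub_le (D i) β b).trans ?_
  simp

variable [IsProbabilityMeasure μ]

theorem abs_integral_criterion_sub_le (h : IsSmoothCriterion μ ℓ s H L)
    (β b : EuclideanSpace ℝ (Fin d)) :
    |∫ w, ℓ β w ∂μ - ∫ w, ℓ b w ∂μ| ≤ L * dist β b := by
  rw [← integral_sub (h.integrable_criterion β) (h.integrable_criterion b)]
  simpa using norm_integral_le_of_norm_le_const (μ := μ)
    (f := fun w => ℓ β w - ℓ b w) (ae_of_all _ fun w => h.abs_criterion_sub_le w β b)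

theorem integrable_score (h : IsSmoothCriterion μ ℓ s H L) (β : EuclideanSpace ℝ (Fin d)) :
    Integrable (s β) μ :=
  .of_bound (h.measurable_score β).aestronglyMeasurable L (ae_of_all _ (h.norm_score_le β))

theorem integrable_hessian (h : IsSmoothCriterion μ ℓ s H L) (β : EuclideanSpace ℝ (Fin d)) :
    Integrable (H β) μ :=
  .of_bound (h.stronglyMeasurable_hessian β).aestronglyMeasurable L
    (ae_of_all _ (h.norm_hessian_le β))

/-- The score has mean zero at a local maximum of the population criterion. -/
theorem integral_score_eq_zero (h : IsSmoothCriterion μ ℓ s H L)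
    {β : EuclideanSpace ℝ (Fin d)} (hβ : IsLocalMax (fun b => ∫ w, ℓ b w ∂μ) β) :
    ∫ w, s β w ∂μ = 0 := by
  have hderiv := hasFDerivAt_integral_of_dominated_of_fderiv_le (𝕜 := ℝ) (μ := μ)
    (F := ℓ) (F' := fun b w => innerSL ℝ (s b w)) (x₀ := β) (bound := fun _ => L) univ_mem
    (Eventually.of_forall fun b => (h.measurable_criterion b).aestronglyMeasurable)
    (h.integrable_criterion β)
    ((innerSL ℝ).continuous.comp_aestronglyMeasurable
      (h.measurable_score β).aestronglyMeasurable)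
    (ae_of_all _ fun w b _ => by simpa using h.norm_score_le b w) (integrable_const L)
    (ae_of_all _ fun w b _ => h.hasFDerivAt_criterion b w)
  have h0 := hβ.hasFDerivAt_eq_zero hderiv
  rw [(innerSL ℝ).integral_comp_comm (h.integrable_score β)] at h0
  rw [← norm_eq_zero, ← innerSL_apply_norm ℝ, h0, norm_zero]

variable {Ω : Type*} [MeasurableSpace Ω] {P : Measure Ω} {D : ℕ → Ω → W}
  {βs : EuclideanSpace ℝ (Fin d)} {K : Set (EuclideanSpace ℝ (Fin d))}
  {βhat : ℕ → Ω → EuclideanSpace ℝ (Fin d)}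

theorem abs_average_criterion_sub_le (h : IsSmoothCriterion μ ℓ s H L) (D : ℕ → W) (n : ℕ)
    (β b : EuclideanSpace ℝ (Fin d)) :
    |(1 / (n : ℝ)) * ∑ i ∈ Finset.range n, ℓ β (D i) -
      (1 / (n : ℝ)) * ∑ i ∈ Finset.range n, ℓ b (D i)| ≤ L * dist β b := by
  have hL : 0 ≤ L := by
    obtain ⟨w⟩ := nonempty_of_isProbabilityMeasure μ
    exact (norm_nonneg _).trans (h.norm_score_le β w)
  rw [← mul_sub, ← Finset.sum_sub_distrib, abs_mul, abs_of_nonneg (by positivity)]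
  rcases n.eq_zero_or_pos with rfl | hn
  · simp; positivity
  rw [one_div_mul_eq_div, div_le_iff₀ (by positivity)]
  refine (Finset.abs_sum_le_sum_abs _ _).trans ?_
  refine (Finset.sum_le_card_nsmul _ _ _ fun i _ => h.abs_criterion_sub_le (D i) β b).trans ?_
  simp [mul_comm]

/-- Almost surely, the empirical criterion converges to the population criterion at every
parameter: the law of large numbers on a countable dense set, extended by equicontinuity. -/
theorem ae_tendsto_average_criterion (h : IsSmoothCriterion μ ℓ s H L)
    (hlaw : ∀ i, HasLaw (D i) μ P) (hindep : iIndepFun D P) :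
    ∀ᵐ ω ∂P, ∀ β, Tendsto (fun n : ℕ => (1 / (n : ℝ)) * ∑ i ∈ Finset.range n, ℓ β (D i ω)) atTop
      (𝓝 (∫ w, ℓ β w ∂μ)) := by
  obtain ⟨t, htc, htd⟩ := TopologicalSpace.exists_countable_dense (EuclideanSpace ℝ (Fin d))
  have hae : ∀ᵐ ω ∂P, ∀ β ∈ t, Tendsto
      (fun n : ℕ => (n : ℝ)⁻¹ • ∑ i ∈ Finset.range n, ℓ β (D i ω)) atTop
      (𝓝 (∫ w, ℓ β w ∂μ)) :=
    (ae_ball_iff htc).2 fun β _ => ae_tendsto_average hlaw hindep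
      (h.measurable_criterion β).stronglyMeasurable (h.integrable_criterion β)
  filter_upwards [hae] with ω hω
  exact tendsto_of_tendsto_dense_of_lipschitz htd
    (fun n β b => h.abs_average_criterion_sub_le (fun i => D i ω) n β b)
    h.abs_integral_criterion_sub_le fun β hβ => by simpa using hω β hβ

/-- Strong consistency of maximizers of the empirical criterion. -/
theorem ae_tendsto_argmax (h : IsSmoothCriterion μ ℓ s H L)
    (hlaw : ∀ i, HasLaw (D i) μ P) (hindep : iIndepFun D P) (hK : IsCompact K)
    (huniq : ∀ β ∈ K, IsMaxOn (fun b => ∫ w, ℓ b w ∂μ) K β → β = βs)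
    (hβhat : ∀ n, ∀ᵐ ω ∂P, βhat n ω ∈ K ∧
      IsMaxOn (fun b => (1 / (n : ℝ)) * ∑ i ∈ Finset.range n, ℓ b (D i ω)) K (βhat n ω)) :
    ∀ᵐ ω ∂P, Tendsto (fun n => βhat n ω) atTop (𝓝 βs) := by
  filter_upwards [h.ae_tendsto_average_criterion hlaw hindep, ae_all_iff.2 hβhat] with ω hlim hω
  exact tendsto_argmax_of_lipschitz hK
    (fun n β b => h.abs_average_criterion_sub_le (fun i => D i ω) n β b) hlim huniq
    (fun n => (hω n).1) fun n => (hω n).2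

/-- The matrix of expected second partial derivatives represents the expected Hessian operator. -/
theorem toEuclideanCLM_eq_integral_hessian (h : IsSmoothCriterion μ ℓ s H L)
    (hsymm : ∀ w u v, inner ℝ (H βs w u) v = inner ℝ u (H βs w v)) {A : Matrix (Fin d) (Fin d) ℝ}
    (hA : ∀ i j, A i j = ∫ w, inner ℝ (H βs w (EuclideanSpace.single i 1))
      (EuclideanSpace.single j 1) ∂μ) :
    Matrix.toEuclideanCLM (𝕜 := ℝ) A = ∫ w, H βs w ∂μ := by
  have hinner (u v : EuclideanSpace ℝ (Fin d)) :
      ∫ w, inner ℝ (H βs w u) v ∂μ = inner ℝ ((∫ w, H βs w ∂μ) u) v := by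
    rw [ContinuousLinearMap.integral_apply (h.integrable_hessian βs), real_inner_comm,
      ← integral_inner ((h.integrable_hessian βs).apply_continuousLinearMap u)]
    simp only [real_inner_comm]
  ext v i
  calc (Matrix.toEuclideanCLM (𝕜 := ℝ) A v) i
      = ∑ j, A i j * v j := by simp [Matrix.mulVec, dotProduct]
    _ = inner ℝ ((∫ w, H βs w ∂μ) (EuclideanSpace.single i 1)) v := by
        simp_rw [hA, hinner]
        simp [PiLp.inner_apply, mul_comm]
    _ = inner ℝ (EuclideanSpace.single i 1) ((∫ w, H βs w ∂μ) v) := by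
        rw [← hinner, real_inner_comm, ← hinner]
        exact integral_congr_ae (ae_of_all _ fun w => by
          dsimp only; rw [hsymm, real_inner_comm])
    _ = ((∫ w, H βs w ∂μ) v) i := by rw [EuclideanSpace.inner_single_left]; simp

/-- The central limit theorem for the scores, transformed by `-A⁻¹`. -/
theorem tendstoInDistribution_sum_score [IsProbabilityMeasure P] (h : IsSmoothCriterion μ ℓ s H L)
    (hlaw : ∀ i, HasLaw (D i) μ P) (hindep : iIndepFun D P) (hmean : ∫ w, s βs w ∂μ = 0)
    {A B : Matrix (Fin d) (Fin d) ℝ} (hA : A.IsHermitian)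
    (hB : ∀ i j, B i j = ∫ w, s βs w i * s βs w j ∂μ) :
    TendstoInDistribution (fun (n : ℕ) ω => (√(n : ℝ))⁻¹ • ∑ i ∈ Finset.range n,
      -Matrix.toEuclideanCLM (𝕜 := ℝ) A⁻¹ (s βs (D i ω))) atTop id (fun _ => P)
      (multivariateGaussian 0 (A⁻¹ * B * A⁻¹)) := by
  have hAinv : A⁻¹ᵀ = A⁻¹ := by simpa using hA.inv.eq
  have hquad (t : EuclideanSpace ℝ (Fin d)) :
      t ⬝ᵥ B *ᵥ t = ∫ w, inner ℝ (s βs w) t ^ 2 ∂μ := by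
    have hint (i j : Fin d) : Integrable (fun w => t i * (s βs w i * s βs w j * t j)) μ := by
      refine ((Integrable.of_bound (C := L * L) ?_ (ae_of_all _ fun w => ?_)).mul_const _).const_mul _
      · have := h.measurable_score βs
        exact Measurable.aestronglyMeasurable (by fun_prop)
      · rw [norm_mul]
        exact mul_le_mul ((PiLp.norm_apply_le _ i).trans (h.norm_score_le βs w))
          ((PiLp.norm_apply_le _ j).trans (h.norm_score_le βs w)) (norm_nonneg _)
          ((norm_nonneg _).trans (h.norm_score_le βs w))
    calc t ⬝ᵥ B *ᵥ t
        = ∑ i, ∑ j, ∫ w, t i * (s βs w i * s βs w j * t j) ∂μ := by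
          simp only [dotProduct, Matrix.mulVec, Finset.mul_sum, hB, integral_const_mul,
            integral_mul_const]
      _ = ∫ w, ∑ i, ∑ j, t i * (s βs w i * s βs w j * t j) ∂μ := by
          rw [integral_finsetSum _ fun i _ => integrable_finsetSum _ fun j _ => hint i j]
          exact Finset.sum_congr rfl fun i _ => (integral_finsetSum _ fun j _ => hint i j).symm
      _ = ∫ w, inner ℝ (s βs w) t ^ 2 ∂μ := by
          refine integral_congr_ae (ae_of_all _ fun w => ?_)
          simp only [PiLp.inner_apply, sq, Finset.sum_mul_sum, RCLike.inner_apply, conj_trivial]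
          exact Finset.sum_congr rfl fun i _ => Finset.sum_congr rfl fun j _ => by ring
  have hB_psd : B.PosSemidef := by
    refine Matrix.PosSemidef.of_dotProduct_mulVec_nonneg ?_ fun x => ?_
    · ext i j
      simp [hB, mul_comm]
    · have := hquad (WithLp.toLp 2 x)
      simp only [star_trivial] at this ⊢
      rw [this]
      positivity
  have hS : (A⁻¹ * B * A⁻¹).PosSemidef := by
    simpa [hAinv] using hB_psd.mul_mul_conjTranspose_same A⁻¹
  have hg : Measurable fun w => -Matrix.toEuclideanCLM (𝕜 := ℝ) A⁻¹ (s βs w) :=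
    ((ContinuousLinearMap.measurable _).comp (h.measurable_score βs)).neg
  -- `A⁻¹` is symmetric, so that it can be moved to the test vector
  have hmove (w : W) (t : EuclideanSpace ℝ (Fin d)) :
      inner ℝ (-Matrix.toEuclideanCLM (𝕜 := ℝ) A⁻¹ (s βs w)) t =
        -inner ℝ (s βs w) (Matrix.toEuclideanCLM (𝕜 := ℝ) A⁻¹ t) := by
    rw [inner_neg_left, real_inner_comm, Matrix.inner_toEuclideanCLM, Matrix.inner_toEuclideanCLM,
      Matrix.dotProduct_mulVec, ← Matrix.mulVec_transpose, hAinv, dotProduct_comm]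
  have hbdd : ∀ w, ‖-Matrix.toEuclideanCLM (𝕜 := ℝ) A⁻¹ (s βs w)‖ ≤
      ‖Matrix.toEuclideanCLM (𝕜 := ℝ) A⁻¹‖ * L := fun w => by
    rw [norm_neg]
    exact (ContinuousLinearMap.le_opNorm _ _).trans (by gcongr; exact h.norm_score_le βs w)
  refine tendstoInDistribution_inv_sqrt_smul_sum (hindep.comp _ fun _ => hg)
    (fun i => ((hlaw i).identDistrib (hlaw 0)).comp hg) ?_ (fun t => ?_) hS fun t => ?_
  · exact MemLp.of_bound (hg.comp_aemeasurable (hlaw 0).aemeasurable).aestronglyMeasurable _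
      (ae_of_all _ fun ω => hbdd _)
  · have := (hlaw 0).integral_comp (f := fun w =>
      (inner ℝ (-Matrix.toEuclideanCLM (𝕜 := ℝ) A⁻¹ (s βs w)) t : ℝ))
      (hg.inner measurable_const).aestronglyMeasurable
    refine this.trans ?_
    simp only [hmove, integral_neg]
    simp_rw [real_inner_comm (Matrix.toEuclideanCLM (𝕜 := ℝ) A⁻¹ t)]
    rw [integral_inner (h.integrable_score βs), hmean, inner_zero_right, neg_zero]
  · have := (hlaw 0).integral_comp (f := fun w =>
      (inner ℝ (-Matrix.toEuclideanCLM (𝕜 := ℝ) A⁻¹ (s βs w)) t ^ 2 : ℝ))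
      ((hg.inner measurable_const).pow_const 2).aestronglyMeasurable
    refine this.trans ?_
    simp only [hmove, neg_sq]
    rw [← hquad, Matrix.ofLp_toEuclideanCLM, ← Matrix.mulVec_mulVec, ← Matrix.mulVec_mulVec,
      Matrix.dotProduct_mulVec t.ofLp, ← Matrix.mulVec_transpose, hAinv]

/-- Asymptotic normality of interior maximizers of the empirical criterion. -/
theorem tendstoInDistribution_argmax [IsProbabilityMeasure P] (h : IsSmoothCriterion μ ℓ s H L)
    (hlaw : ∀ i, HasLaw (D i) μ P) (hindep : iIndepFun D P)
    (hsymm : ∀ w u v, inner ℝ (H βs w u) v = inner ℝ u (H βs w v))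
    (hβs_int : βs ∈ interior K) (hβs_max : IsMaxOn (fun b => ∫ w, ℓ b w ∂μ) K βs)
    (hβhat_meas : ∀ n, AEMeasurable (βhat n) P)
    (hβhat : ∀ n, ∀ᵐ ω ∂P, βhat n ω ∈ K ∧
      IsMaxOn (fun b => (1 / (n : ℝ)) * ∑ i ∈ Finset.range n, ℓ b (D i ω)) K (βhat n ω))
    (hlim : ∀ᵐ ω ∂P, Tendsto (fun n => βhat n ω) atTop (𝓝 βs))
    {A B : Matrix (Fin d) (Fin d) ℝ}
    (hA : ∀ i j, A i j = ∫ w, inner ℝ (H βs w (EuclideanSpace.single i 1))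
      (EuclideanSpace.single j 1) ∂μ)
    (hB : ∀ i j, B i j = ∫ w, s βs w i * s βs w j ∂μ) (hunit : IsUnit A) :
    TendstoInDistribution (fun (n : ℕ) ω => √(n : ℝ) • (βhat n ω - βs)) atTop id (fun _ => P)
      (multivariateGaussian 0 (A⁻¹ * B * A⁻¹)) := by
  have hmean := h.integral_score_eq_zero
    (hβs_max.isLocalMax (mem_interior_iff_mem_nhds.1 hβs_int))
  have hA_herm : A.IsHermitian := by
    ext i j
    rw [Matrix.conjTranspose_apply, hA, hA]
    simp only [hsymm, star_trivial]
    exact integral_congr_ae (ae_of_all _ fun w => by dsimp only; rw [← hsymm, real_inner_comm])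
  have hA_int := h.toEuclideanCLM_eq_integral_hessian hsymm hA
  set A' := Matrix.toEuclideanCLM (𝕜 := ℝ) A⁻¹ with hA'
  have hA'_left (v : EuclideanSpace ℝ (Fin d)) : A' ((∫ w, H βs w ∂μ) v) = v := by
    rw [← hA_int, hA', ← mul_apply_eq_comp, ← map_mul,
      Matrix.nonsing_inv_mul _ ((Matrix.isUnit_iff_isUnit_det A).1 hunit), map_one,
      one_apply_eq_self]
  refine tendstoInDistribution_of_norm_sub_le
    (h.tendstoInDistribution_sum_score hlaw hindep hmean hA_herm hB)
    (fun n => ((hβhat_meas n).sub_const βs).fun_const_smul _) ?_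
  filter_upwards [hlim, ae_all_iff.2 hβhat, ae_tendsto_average hlaw hindep
    (h.stronglyMeasurable_hessian βs) (h.integrable_hessian βs)] with ω hω hmax hH
  -- the relative error of the linearization: it bounds `‖A⁻¹‖` times the error in replacing the
  -- average Hessian by its limit, plus the Taylor remainder
  set δ : ℕ → ℝ := fun n => ‖A'‖ * (L * ‖βhat n ω - βs‖ +
    ‖(n : ℝ)⁻¹ • ∑ i ∈ Finset.range n, H βs (D i ω) - ∫ w, H βs w ∂μ‖) with hδ
  have hδ0 : Tendsto δ atTop (𝓝 0) := by
    simpa using (((tendsto_iff_norm_sub_tendsto_zero.1 hω).const_mul L).add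
      (tendsto_iff_norm_sub_tendsto_zero.1 hH)).const_mul ‖A'‖
  refine ⟨fun n => 2 * δ n, by simpa using hδ0.const_mul 2, ?_⟩
  filter_upwards [hδ0.eventually_lt_const (by norm_num : (0 : ℝ) < 1 / 2), eventually_ne_atTop 0,
    hω.eventually (isOpen_interior.mem_nhds hβs_int)] with n hδn hn hint
  have hlin := h.norm_average_score_add_le hn (β := βs)
    (h.sum_score_eq_zero (D := fun i => D i ω) hn hint (hmax n).2)
  set T := (n : ℝ)⁻¹ • ∑ i ∈ Finset.range n, s βs (D i ω) with hT
  set An := (n : ℝ)⁻¹ • ∑ i ∈ Finset.range n, H βs (D i ω) with hAn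
  set v := βhat n ω - βs with hv
  have hU : (√(n : ℝ))⁻¹ • ∑ i ∈ Finset.range n, -A' (s βs (D i ω)) = -(√(n : ℝ) • A' T) := by
    rw [Finset.sum_neg_distrib, smul_neg, ← map_sum, hT, map_smul, smul_smul]
    congr 2
    have : (0 : ℝ) < n := by positivity
    field_simp
    rw [Real.sq_sqrt this.le]
  have herr : ‖v + A' T‖ ≤ δ n * ‖v‖ := by
    have heq : v + A' T = A' (T + An v) - A' ((An - ∫ w, H βs w ∂μ) v) := by
      rw [sub_apply, map_sub A', hA'_left, map_add]
      abel
    rw [heq]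
    calc ‖A' (T + An v) - A' ((An - ∫ w, H βs w ∂μ) v)‖
        ≤ ‖A'‖ * ‖T + An v‖ + ‖A'‖ * ‖(An - ∫ w, H βs w ∂μ) v‖ :=
          (norm_sub_le _ _).trans (add_le_add (A'.le_opNorm _) (A'.le_opNorm _))
      _ ≤ ‖A'‖ * (L * ‖v‖ * ‖v‖) + ‖A'‖ * (‖An - ∫ w, H βs w ∂μ‖ * ‖v‖) := by
          gcongr
          exact ContinuousLinearMap.le_opNorm _ _
      _ = δ n * ‖v‖ := by rw [hδ]; ring
  have hvT : ‖v‖ ≤ 2 * ‖A' T‖ := by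
    have h1 : ‖v‖ ≤ ‖v + A' T‖ + ‖A' T‖ := by simpa using norm_sub_le (v + A' T) (A' T)
    nlinarith [norm_nonneg v]
  have hδnn : 0 ≤ δ n := by
    have hL : 0 ≤ L := (norm_nonneg _).trans (h.norm_score_le βs (D 0 ω))
    positivity
  rw [hU, sub_neg_eq_add, ← smul_add, norm_smul, norm_neg, norm_smul]
  calc ‖√(n : ℝ)‖ * ‖v + A' T‖ ≤ ‖√(n : ℝ)‖ * (δ n * (2 * ‖A' T‖)) := by
        gcongr
        exact herr.trans (by gcongr)
    _ = 2 * δ n * (‖√(n : ℝ)‖ * ‖A' T‖) := by ring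

end IsSmoothCriterion

end MEstimation

/-! ### Bounded Lipschitz functions -/

section BoundedLipschitz

/-- Bounded and globally Lipschitz functions on the line. -/
def IsBoundedLipschitz (f : ℝ → ℝ) : Prop :=
  ∃ C, (∀ x, |f x| ≤ C) ∧ ∀ x y, |f x - f y| ≤ C * |x - y|

variable {f g f' : ℝ → ℝ}

theorem isBoundedLipschitz_of_bounds {C C' : ℝ} (hC : ∀ x, |f x| ≤ C)
    (hC' : ∀ x y, |f x - f y| ≤ C' * |x - y|) : IsBoundedLipschitz f :=
  ⟨max C C', fun x => (hC x).trans (le_max_left _ _), fun x y => (hC' x y).trans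
    (mul_le_mul_of_nonneg_right (le_max_right _ _) (abs_nonneg _))⟩

theorem isBoundedLipschitz_of_hasDerivAt {C C' : ℝ} (hC : ∀ x, |f x| ≤ C)
    (hf : ∀ x, HasDerivAt f (f' x) x) (hC' : ∀ x, |f' x| ≤ C') : IsBoundedLipschitz f :=
  isBoundedLipschitz_of_bounds hC fun x y =>
    convex_univ.norm_image_sub_le_of_norm_hasDerivWithin_le
      (fun z _ => (hf z).hasDerivWithinAt) (fun z _ => hC' z) (mem_univ y) (mem_univ x)

namespace IsBoundedLipschitz

theorem continuous (hf : IsBoundedLipschitz f) : Continuous f := by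
  obtain ⟨C, _, hC⟩ := hf
  exact (LipschitzWith.of_dist_le' (K := C) hC).continuous

theorem sub (hf : IsBoundedLipschitz f) (hg : IsBoundedLipschitz g) :
    IsBoundedLipschitz fun x => f x - g x := by
  obtain ⟨C, hC, hC'⟩ := hf
  obtain ⟨D, hD, hD'⟩ := hg
  refine ⟨C + D, fun x => (abs_sub _ _).trans (add_le_add (hC x) (hD x)), fun x y => ?_⟩
  calc |f x - g x - (f y - g y)| = |(f x - f y) - (g x - g y)| := by ring_nf
    _ ≤ |f x - f y| + |g x - g y| := abs_sub _ _
    _ ≤ (C + D) * |x - y| := by linarith [hC' x y, hD' x y]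

theorem mul (hf : IsBoundedLipschitz f) (hg : IsBoundedLipschitz g) :
    IsBoundedLipschitz fun x => f x * g x := by
  obtain ⟨C, hC, hC'⟩ := hf
  obtain ⟨D, hD, hD'⟩ := hg
  have hC0 : 0 ≤ C := (abs_nonneg _).trans (hC 0)
  refine isBoundedLipschitz_of_bounds (C := C * D) (C' := 2 * C * D) (fun x => ?_) fun x y => ?_
  · rw [abs_mul]
    exact mul_le_mul (hC x) (hD x) (abs_nonneg _) hC0
  · calc |f x * g x - f y * g y| = |(f x - f y) * g x + f y * (g x - g y)| := by ring_nf
      _ ≤ |f x - f y| * |g x| + |f y| * |g x - g y| := by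
          simpa [abs_mul] using abs_add_le ((f x - f y) * g x) (f y * (g x - g y))
      _ ≤ (C * |x - y|) * D + C * (D * |x - y|) := by
          gcongr
          exacts [hC' x y, hD x, hC y, hD' x y]
      _ = 2 * C * D * |x - y| := by ring

theorem inv {c : ℝ} (hf : IsBoundedLipschitz f) (hc : 0 < c) (hfc : ∀ x, c ≤ f x) :
    IsBoundedLipschitz fun x => (f x)⁻¹ := by
  obtain ⟨C, hC, hC'⟩ := hf
  have hpos (x : ℝ) : 0 < f x := hc.trans_le (hfc x)
  refine isBoundedLipschitz_of_bounds (C := c⁻¹) (C' := C / (c * c)) (fun x => ?_) fun x y => ?_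
  · rw [abs_of_pos (inv_pos.2 (hpos x))]
    exact inv_anti₀ hc (hfc x)
  · rw [inv_sub_inv (hpos x).ne' (hpos y).ne', abs_div, abs_of_pos (mul_pos (hpos x) (hpos y)),
      abs_sub_comm, div_mul_eq_mul_div]
    exact div_le_div₀ ((abs_nonneg _).trans (hC' x y)) (hC' x y) (mul_pos hc hc)
      (mul_le_mul (hfc x) (hfc y) hc.le (hpos x).le)

theorem div {c : ℝ} (hf : IsBoundedLipschitz f) (hg : IsBoundedLipschitz g) (hc : 0 < c)
    (hgc : ∀ x, c ≤ g x) : IsBoundedLipschitz fun x => f x / g x := by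
  simpa only [div_eq_mul_inv] using hf.mul (hg.inv hc hgc)

theorem const_mul (hf : IsBoundedLipschitz f) (c : ℝ) : IsBoundedLipschitz fun x => c * f x :=
  IsBoundedLipschitz.mul (f := fun _ => c) ⟨|c|, fun _ => le_rfl, fun x y => by simp; positivity⟩ hf

end IsBoundedLipschitz

end BoundedLipschitz

/-! ### The asymmetric Laplace noise -/

section Noise

variable (m : Survey)

/-- The density of the noise `Y - ⟨β, x⟩` in the asymmetric Laplace model. -/
noncomputable def noiseDensity (u : ℝ) : ℝ := asymLaplaceDensity m 0 u

theorem asymLaplaceDensity_eq (μ y : ℝ) : asymLaplaceDensity m μ y = noiseDensity m (y - μ) := by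
  simp [noiseDensity, asymLaplaceDensity]

theorem checkLoss_eq_max {α : ℝ} (τ : ℝ) : checkLoss α τ = max ((α - 1) * τ) (α * τ) := by
  unfold checkLoss
  split_ifs with h
  · rw [max_eq_left (by nlinarith)]
  · rw [max_eq_right (by nlinarith)]

theorem checkLoss_nonneg {α : ℝ} (h0 : 0 ≤ α) (h1 : α ≤ 1) (τ : ℝ) : 0 ≤ checkLoss α τ := by
  unfold checkLoss
  split_ifs with h <;> nlinarith

theorem abs_checkLoss_sub_le {α : ℝ} (h0 : 0 ≤ α) (h1 : α ≤ 1) (x y : ℝ) :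
    |checkLoss α x - checkLoss α y| ≤ |x - y| := by
  rw [checkLoss_eq_max, checkLoss_eq_max]
  refine (abs_max_sub_max_le_max _ _ _ _).trans (max_le ?_ ?_)
  · rw [← mul_sub, abs_mul]
    exact mul_le_of_le_one_left (abs_nonneg _) (abs_le.2 ⟨by linarith, by linarith⟩)
  · rw [← mul_sub, abs_mul]
    exact mul_le_of_le_one_left (abs_nonneg _) (abs_le.2 ⟨by linarith, by linarith⟩)

theorem noiseDensity_pos (u : ℝ) : 0 < noiseDensity m u := by
  have := m.α_pos; have := m.α_lt_one; have := m.σ_pos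
  exact mul_pos (div_pos (mul_pos m.α_pos (by linarith)) m.σ_pos) (Real.exp_pos _)

theorem isBoundedLipschitz_noiseDensity : IsBoundedLipschitz (noiseDensity m) := by
  have h0 := m.α_pos; have h1 := m.α_lt_one; have hσ := m.σ_pos
  refine IsBoundedLipschitz.const_mul (f := fun u => Real.exp (-checkLoss m.α ((u - 0) / m.σ))) ?_ _
  have hnn (u : ℝ) := checkLoss_nonneg h0.le h1.le ((u - 0) / m.σ)
  refine isBoundedLipschitz_of_bounds (C := 1) (C' := 1 / m.σ) (fun u => ?_) fun u v => ?_
  · rw [abs_of_pos (Real.exp_pos _), Real.exp_le_one_iff]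
    linarith [hnn u]
  · -- `exp` is `1`-Lipschitz on the nonpositive half line
    have hexp : ∀ a ≤ (0 : ℝ), ∀ b ≤ (0 : ℝ), |Real.exp a - Real.exp b| ≤ |a - b| := by
      intro a ha b hb
      simpa using (convex_Iic (0 : ℝ)).norm_image_sub_le_of_norm_hasDerivWithin_le (C := 1)
        (fun x _ => (Real.hasDerivAt_exp x).hasDerivWithinAt)
        (fun x hx => by simpa using hx) (mem_Iic.2 hb) (mem_Iic.2 ha)
    refine (hexp _ (by linarith [hnn u]) _ (by linarith [hnn v])).trans ?_
    rw [neg_sub_neg, abs_sub_comm]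
    refine (abs_checkLoss_sub_le h0.le h1.le _ _).trans (le_of_eq ?_)
    rw [← sub_div, abs_div, abs_of_pos hσ]
    simp [div_eq_inv_mul]

theorem integrable_noiseDensity : Integrable (noiseDensity m) := by
  have h0 := m.α_pos; have h1 := m.α_lt_one; have hσ := m.σ_pos
  rw [← integrableOn_univ, ← Iic_union_Ioi (a := (0 : ℝ)), integrableOn_union]
  constructor
  · refine IntegrableOn.congr_fun ((integrableOn_exp_mul_Iic (a := (1 - m.α) / m.σ)
      (div_pos (by linarith) hσ) 0).const_mul (m.α * (1 - m.α) / m.σ)) (fun u hu => ?_)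
      measurableSet_Iic
    have hu' : u / m.σ ≤ 0 := div_nonpos_of_nonpos_of_nonneg hu hσ.le
    simp only [noiseDensity, asymLaplaceDensity, checkLoss, sub_zero, if_pos hu']
    congr 2
    ring
  · refine IntegrableOn.congr_fun ((integrableOn_exp_mul_Ioi (a := -(m.α / m.σ))
      (neg_lt_zero.2 (div_pos h0 hσ)) 0).const_mul (m.α * (1 - m.α) / m.σ)) (fun u hu => ?_)
      measurableSet_Ioi
    have hu' : ¬ u / m.σ ≤ 0 := not_le.2 (div_pos hu hσ)
    simp only [noiseDensity, asymLaplaceDensity, checkLoss, sub_zero, if_neg hu']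
    congr 2
    ring

theorem integral_noiseDensity_pos : 0 < ∫ u, noiseDensity m u := by
  rw [integral_pos_iff_support_of_nonneg (fun u => (noiseDensity_pos m u).le)
    (integrable_noiseDensity m)]
  have : Function.support (noiseDensity m) = univ :=
    eq_univ_of_forall fun u => (noiseDensity_pos m u).ne'
  simp [this]

end Noise

/-! ### The privatization mechanism -/

section Mechanism

variable (m : Survey)

/-- The slope of the bit flip probability `bitFlip m z` in its input. -/
noncomputable def flipSlope (z : Bool) : ℝ :=
  (if z = true then 1 else -1) / ((m.hi - m.lo) * flipConst m.ε)

theorem bitFlip_eq (z : Bool) (v : ℝ) :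
    bitFlip m z v = 1 / 2 + flipSlope m z * (v - (m.hi + m.lo) / 2) := by
  cases z <;> simp only [bitFlip, flipSlope, if_true, Bool.false_eq_true, if_false] <;> ring

theorem one_lt_flipConst : 1 < flipConst m.ε := by
  have h : 1 < Real.exp m.ε := Real.one_lt_exp_iff.2 m.ε_pos
  rw [flipConst, one_lt_div (by linarith)]
  linarith

theorem truncate_mem (y : ℝ) : truncate m y ∈ Icc m.lo m.hi :=
  ⟨le_max_left _ _, max_le m.lo_lt_hi.le (min_le_right _ _)⟩

theorem continuous_bitFlip_truncate (z : Bool) :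
    Continuous fun y => bitFlip m z (truncate m y) := by
  simp only [bitFlip_eq, truncate]
  fun_prop

/-- The probability of releasing either bit is bounded away from zero: this is where the
privatization regularizes the likelihood. -/
theorem bitFlip_truncate_mem (z : Bool) (y : ℝ) :
    bitFlip m z (truncate m y) ∈ Icc (1 / 2 * (1 - (flipConst m.ε)⁻¹)) 1 := by
  have hC := one_lt_flipConst m
  have hlh := m.lo_lt_hi
  have hC0 : 0 < (flipConst m.ε)⁻¹ := by positivity
  have hC1 : (flipConst m.ε)⁻¹ < 1 := inv_lt_one_of_one_lt₀ hC
  obtain ⟨h1, h2⟩ := truncate_mem m y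
  have habs : |flipSlope m z * (truncate m y - (m.hi + m.lo) / 2)| ≤
      1 / 2 * (flipConst m.ε)⁻¹ := by
    have hs : |flipSlope m z| = (m.hi - m.lo)⁻¹ * (flipConst m.ε)⁻¹ := by
      rw [flipSlope, abs_div, abs_of_pos (mul_pos (sub_pos.2 hlh) (by linarith)), ← mul_inv]
      cases z <;> simp
    have ht : |truncate m y - (m.hi + m.lo) / 2| ≤ 1 / 2 * (m.hi - m.lo) :=
      abs_le.2 ⟨by linarith, by linarith⟩
    have hd : 0 < m.hi - m.lo := sub_pos.2 hlh
    rw [abs_mul, hs]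
    calc (m.hi - m.lo)⁻¹ * (flipConst m.ε)⁻¹ * |truncate m y - (m.hi + m.lo) / 2|
        ≤ (m.hi - m.lo)⁻¹ * (flipConst m.ε)⁻¹ * (1 / 2 * (m.hi - m.lo)) := by gcongr
      _ = 1 / 2 * (flipConst m.ε)⁻¹ := by field_simp
  rw [bitFlip_eq]
  constructor <;> linarith [abs_le.1 habs]

theorem hasDerivAt_truncate {y : ℝ} (hlo : y ≠ m.lo) (hhi : y ≠ m.hi) :
    HasDerivAt (truncate m) ((Ioo m.lo m.hi).indicator 1 y) y := by
  have hlh := m.lo_lt_hi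
  rcases lt_or_gt_of_ne hlo with h | h
  · rw [indicator_of_notMem fun h' => h.not_gt h'.1]
    refine (hasDerivAt_const y m.lo).congr_of_eventuallyEq ?_
    filter_upwards [Iio_mem_nhds h] with v hv
    exact max_eq_left ((min_le_left _ _).trans (le_of_lt hv))
  rcases lt_or_gt_of_ne hhi with h' | h'
  · rw [indicator_of_mem (show y ∈ Ioo m.lo m.hi from ⟨h, h'⟩)]
    refine (hasDerivAt_id y).congr_of_eventuallyEq ?_
    filter_upwards [Ioo_mem_nhds h h'] with v hv
    simp [truncate, hv.1.le, hv.2.le]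
  · rw [indicator_of_notMem fun h'' => h'.not_gt h''.2]
    refine (hasDerivAt_const y m.hi).congr_of_eventuallyEq ?_
    filter_upwards [Ioi_mem_nhds h'] with v hv
    simp [truncate, (mem_Ioi.1 hv).le, hlh.le]

theorem abs_truncate_sub_le (x y : ℝ) : |truncate m x - truncate m y| ≤ |x - y| := by
  refine (abs_max_sub_max_le_max _ _ _ _).trans (max_le (by simp) ?_)
  exact (abs_min_sub_min_le_max _ _ _ _).trans (max_le le_rfl (by simp))

end Mechanism

/-! ### The response probability as a function of the linear predictor -/

section Response

variable (m : Survey)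

/-- The model probability of the bit `z` when the linear predictor is `θ`. -/
noncomputable def responseProb (z : Bool) (θ : ℝ) : ℝ :=
  ∫ u, bitFlip m z (truncate m (θ + u)) * noiseDensity m u

/-- The derivative of `responseProb m z`. -/
noncomputable def responseProbDeriv (z : Bool) (θ : ℝ) : ℝ :=
  flipSlope m z * ∫ u in (m.lo - θ)..(m.hi - θ), noiseDensity m u

/-- The second derivative of `responseProb m z`. -/
noncomputable def responseProbDeriv₂ (z : Bool) (θ : ℝ) : ℝ :=
  flipSlope m z * (noiseDensity m (m.lo - θ) - noiseDensity m (m.hi - θ))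

theorem releaseProb_modelLaw {d : ℕ} (β x : EuclideanSpace ℝ (Fin d)) (z : Bool) :
    releaseProb m (modelLaw m β x) z = responseProb m z (inner ℝ β x) := by
  have hk := (isBoundedLipschitz_noiseDensity m).continuous
  simp only [releaseProb, modelLaw, asymLaplaceDensity_eq]
  rw [integral_withDensity_eq_integral_toReal_smul
    (by fun_prop : Measurable fun y => ENNReal.ofReal (noiseDensity m (y - inner ℝ β x)))
    (ae_of_all _ fun _ => ENNReal.ofReal_lt_top), responseProb]
  rw [← integral_add_right_eq_self _ (inner ℝ β x : ℝ)]
  refine integral_congr_ae (ae_of_all _ fun u => ?_)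
  dsimp only
  rw [add_sub_cancel_right, ENNReal.toReal_ofReal (noiseDensity_pos m u).le, smul_eq_mul, mul_comm,
    add_comm]

theorem integrable_bitFlip_mul_noiseDensity (z : Bool) (θ : ℝ) :
    Integrable fun u => bitFlip m z (truncate m (θ + u)) * noiseDensity m u := by
  refine (integrable_noiseDensity m).bdd_mul (c := 1)
    ((continuous_bitFlip_truncate m z).comp
      (continuous_const.add continuous_id)).aestronglyMeasurable (ae_of_all _ fun u => ?_)
  have hC1 := inv_lt_one_of_one_lt₀ (one_lt_flipConst m)
  obtain ⟨h1, h2⟩ := bitFlip_truncate_mem m z (θ + u)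
  exact abs_le.2 ⟨by linarith, h2⟩

theorem exists_le_responseProb_le : ∃ a > 0, ∃ b, ∀ z θ, responseProb m z θ ∈ Icc a b := by
  have hC1 := inv_lt_one_of_one_lt₀ (one_lt_flipConst m)
  refine ⟨1 / 2 * (1 - (flipConst m.ε)⁻¹) * ∫ u, noiseDensity m u,
    mul_pos (by linarith) (integral_noiseDensity_pos m), 1 * ∫ u, noiseDensity m u,
    fun z θ => ⟨?_, ?_⟩⟩
  · rw [← integral_const_mul]
    exact integral_mono ((integrable_noiseDensity m).const_mul _)
      (integrable_bitFlip_mul_noiseDensity m z θ) fun u => mul_le_mul_of_nonneg_right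
        (bitFlip_truncate_mem m z _).1 (noiseDensity_pos m u).le
  · rw [← integral_const_mul]
    exact integral_mono (integrable_bitFlip_mul_noiseDensity m z θ)
      ((integrable_noiseDensity m).const_mul _) fun u => mul_le_mul_of_nonneg_right
        (bitFlip_truncate_mem m z _).2 (noiseDensity_pos m u).le

theorem hasDerivAt_responseProb (z : Bool) (θ : ℝ) :
    HasDerivAt (responseProb m z) (responseProbDeriv m z θ) θ := by
  have hk := (isBoundedLipschitz_noiseDensity m).continuous
  have key := hasDerivAt_integral_of_dominated_loc_of_lip (𝕜 := ℝ) (μ := volume) (x₀ := θ)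
    (F := fun θ u => bitFlip m z (truncate m (θ + u)) * noiseDensity m u)
    (F' := fun u => flipSlope m z * (Ioo (m.lo - θ) (m.hi - θ)).indicator (noiseDensity m) u)
    (bound := fun u => |flipSlope m z| * noiseDensity m u) univ_mem
    (Eventually.of_forall fun θ' =>
      (integrable_bitFlip_mul_noiseDensity m z θ').aestronglyMeasurable)
    (integrable_bitFlip_mul_noiseDensity m z θ)
    ((hk.measurable.indicator measurableSet_Ioo).const_mul _).aestronglyMeasurable ?_
    ((integrable_noiseDensity m).const_mul _) ?_
  · refine key.2.congr_deriv ?_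
    rw [integral_const_mul, integral_indicator measurableSet_Ioo, responseProbDeriv,
      intervalIntegral.integral_of_le (by linarith [m.lo_lt_hi]), integral_Ioc_eq_integral_Ioo]
  · refine ae_of_all _ fun u => LipschitzOnWith.of_dist_le_mul fun x _ y _ => ?_
    have hk0 := noiseDensity_pos m u
    rw [Real.coe_nnabs, abs_of_nonneg (by positivity), Real.dist_eq, Real.dist_eq, ← sub_mul,
      abs_mul, abs_of_pos hk0, bitFlip_eq, bitFlip_eq, add_sub_add_left_eq_sub, ← mul_sub, abs_mul,
      sub_sub_sub_cancel_right, mul_right_comm]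
    gcongr ?_ * _ * ?_
    simpa using abs_truncate_sub_le m (x + u) (y + u)
  · -- the integrand is differentiable in `θ` off the two kinks of the truncation
    filter_upwards [(measure_singleton (m.lo - θ) : volume _ = 0) |> compl_mem_ae_iff.2,
      (measure_singleton (m.hi - θ) : volume _ = 0) |> compl_mem_ae_iff.2] with u hlo hhi
    have ht : HasDerivAt (fun θ' => truncate m (θ' + u))
        ((Ioo m.lo m.hi).indicator 1 (θ + u)) θ :=
      (hasDerivAt_truncate m (fun h => hlo (by simp [← h]))
        (fun h => hhi (by simp [← h]))).comp_add_const θ u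
    have := (((ht.sub_const ((m.hi + m.lo) / 2)).const_mul (flipSlope m z)).const_add
      (1 / 2)).mul_const (noiseDensity m u)
    simp only [← bitFlip_eq] at this
    refine this.congr_deriv ?_
    rw [mul_assoc]
    congr 1
    by_cases hu : θ + u ∈ Ioo m.lo m.hi
    · have hu' : u ∈ Ioo (m.lo - θ) (m.hi - θ) := ⟨by linarith [hu.1], by linarith [hu.2]⟩
      simp [indicator_of_mem hu, indicator_of_mem hu']
    · have hu' : u ∉ Ioo (m.lo - θ) (m.hi - θ) := fun h =>
        hu ⟨by linarith [h.1], by linarith [h.2]⟩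
      simp [indicator_of_notMem hu, indicator_of_notMem hu']

theorem hasDerivAt_responseProbDeriv (z : Bool) (θ : ℝ) :
    HasDerivAt (responseProbDeriv m z) (responseProbDeriv₂ m z θ) θ := by
  have hk := (isBoundedLipschitz_noiseDensity m).continuous
  have hprim (a : ℝ) : HasDerivAt (fun θ => ∫ u in (0 : ℝ)..(a - θ), noiseDensity m u)
      (-noiseDensity m (a - θ)) θ := by
    have := (hk.integral_hasStrictDerivAt 0 (a - θ)).hasDerivAt
    exact (this.comp θ ((hasDerivAt_id θ).const_sub a)).congr_deriv (by simp)
  have heq : responseProbDeriv m z = fun θ => flipSlope m z *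
      ((∫ u in (0 : ℝ)..(m.hi - θ), noiseDensity m u) -
        ∫ u in (0 : ℝ)..(m.lo - θ), noiseDensity m u) := by
    ext θ
    rw [responseProbDeriv, intervalIntegral.integral_interval_sub_left
      (hk.intervalIntegrable _ _) (hk.intervalIntegrable _ _)]
  rw [heq]
  refine (((hprim m.hi).sub (hprim m.lo)).const_mul (flipSlope m z)).congr_deriv ?_
  rw [responseProbDeriv₂]
  ring

theorem isBoundedLipschitz_responseProbDeriv₂ (z : Bool) :
    IsBoundedLipschitz (responseProbDeriv₂ m z) := by
  have hshift (a : ℝ) : IsBoundedLipschitz fun θ => noiseDensity m (a - θ) := by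
    obtain ⟨C, hC, hC'⟩ := isBoundedLipschitz_noiseDensity m
    refine ⟨C, fun θ => hC _, fun x y => (hC' _ _).trans (le_of_eq ?_)⟩
    rw [sub_sub_sub_cancel_left, abs_sub_comm]
  exact ((hshift m.lo).sub (hshift m.hi)).const_mul _

theorem isBoundedLipschitz_responseProbDeriv (z : Bool) :
    IsBoundedLipschitz (responseProbDeriv m z) := by
  obtain ⟨C', hC', _⟩ := isBoundedLipschitz_responseProbDeriv₂ m z
  refine isBoundedLipschitz_of_hasDerivAt (C := |flipSlope m z| * ∫ u, noiseDensity m u)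
    (fun θ => ?_) (hasDerivAt_responseProbDeriv m z) hC'
  rw [responseProbDeriv, abs_mul, intervalIntegral.integral_of_le (by linarith [m.lo_lt_hi]),
    abs_of_nonneg (integral_nonneg fun u => (noiseDensity_pos m u).le)]
  exact mul_le_mul_of_nonneg_left (setIntegral_le_integral (integrable_noiseDensity m)
    (ae_of_all _ fun u => (noiseDensity_pos m u).le)) (abs_nonneg _)

theorem isBoundedLipschitz_responseProb (z : Bool) : IsBoundedLipschitz (responseProb m z) := by
  obtain ⟨C', hC', _⟩ := isBoundedLipschitz_responseProbDeriv m z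
  obtain ⟨a, ha, b, hab⟩ := exists_le_responseProb_le m
  exact isBoundedLipschitz_of_hasDerivAt (C := b)
    (fun θ => abs_le.2 ⟨by linarith [(hab z θ).1, (hab z θ).2], (hab z θ).2⟩)
    (hasDerivAt_responseProb m z) hC'

/-- The derivative of `log (responseProb m z)`. -/
noncomputable def logResponseDeriv (z : Bool) (θ : ℝ) : ℝ :=
  responseProbDeriv m z θ / responseProb m z θ

/-- The second derivative of `log (responseProb m z)`. -/
noncomputable def logResponseDeriv₂ (z : Bool) (θ : ℝ) : ℝ :=
  responseProbDeriv₂ m z θ / responseProb m z θ - logResponseDeriv m z θ * logResponseDeriv m z θ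

theorem isBoundedLipschitz_logResponseDeriv (z : Bool) :
    IsBoundedLipschitz (logResponseDeriv m z) := by
  obtain ⟨a, ha, b, hab⟩ := exists_le_responseProb_le m
  exact (isBoundedLipschitz_responseProbDeriv m z).div (isBoundedLipschitz_responseProb m z) ha
    fun θ => (hab z θ).1

theorem isBoundedLipschitz_logResponseDeriv₂ (z : Bool) :
    IsBoundedLipschitz (logResponseDeriv₂ m z) := by
  obtain ⟨a, ha, b, hab⟩ := exists_le_responseProb_le m
  exact ((isBoundedLipschitz_responseProbDeriv₂ m z).div (isBoundedLipschitz_responseProb m z) ha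
    fun θ => (hab z θ).1).sub
      ((isBoundedLipschitz_logResponseDeriv m z).mul (isBoundedLipschitz_logResponseDeriv m z))

theorem responseProb_pos (z : Bool) (θ : ℝ) : 0 < responseProb m z θ := by
  obtain ⟨a, ha, b, hab⟩ := exists_le_responseProb_le m
  exact ha.trans_le (hab z θ).1

theorem hasDerivAt_log_responseProb_mul (z : Bool) (θ : ℝ) {c : ℝ} (hc : c ≠ 0) :
    HasDerivAt (fun θ => Real.log (responseProb m z θ * c)) (logResponseDeriv m z θ) θ := by
  have hp := (responseProb_pos m z θ).ne'
  have := ((hasDerivAt_responseProb m z θ).mul_const c).log (mul_ne_zero hp hc)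
  refine this.congr_deriv ?_
  rw [logResponseDeriv]
  field_simp

theorem hasDerivAt_logResponseDeriv (z : Bool) (θ : ℝ) :
    HasDerivAt (logResponseDeriv m z) (logResponseDeriv₂ m z θ) θ := by
  have hp := (responseProb_pos m z θ).ne'
  have := (hasDerivAt_responseProbDeriv m z θ).div (hasDerivAt_responseProb m z θ) hp
  refine this.congr_deriv ?_
  rw [logResponseDeriv₂, logResponseDeriv]
  field_simp

end Response

/-! ### Smoothness of the log-likelihood -/

section Criterion

variable (m : Survey) {d : ℕ}

/-- The covariate, set to `0` off the cube, where the log-density vanishes identically. -/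
noncomputable def cubeCovariate (x : EuclideanSpace ℝ (Fin d)) : EuclideanSpace ℝ (Fin d) :=
  (cube d).indicator id x

/-- The score `∂ log p_β / ∂β`. -/
noncomputable def score (β : EuclideanSpace ℝ (Fin d)) (w : EuclideanSpace ℝ (Fin d) × Bool) :
    EuclideanSpace ℝ (Fin d) :=
  logResponseDeriv m w.2 (inner ℝ β w.1) • cubeCovariate w.1

/-- The Hessian `∂² log p_β / ∂β²`, as a linear map. -/
noncomputable def scoreDeriv (β : EuclideanSpace ℝ (Fin d))
    (w : EuclideanSpace ℝ (Fin d) × Bool) :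
    EuclideanSpace ℝ (Fin d) →L[ℝ] EuclideanSpace ℝ (Fin d) :=
  logResponseDeriv₂ m w.2 (inner ℝ β w.1) •
    (innerSL ℝ (cubeCovariate w.1)).smulRight (cubeCovariate w.1)

theorem measurableSet_cube : MeasurableSet (cube d) := by
  have : cube d = ⋂ j, (fun x : EuclideanSpace ℝ (Fin d) => x j) ⁻¹' Icc (-1) 1 := by
    ext x; simp [cube]
  rw [this]
  exact MeasurableSet.iInter fun j => measurableSet_Icc.preimage (by fun_prop)

theorem measurable_cubeCovariate :
    Measurable (cubeCovariate : EuclideanSpace ℝ (Fin d) → EuclideanSpace ℝ (Fin d)) :=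
  measurable_id.indicator measurableSet_cube

theorem norm_cubeCovariate_le (x : EuclideanSpace ℝ (Fin d)) : ‖cubeCovariate x‖ ≤ √d := by
  rw [cubeCovariate]
  by_cases hx : x ∈ cube d
  · rw [indicator_of_mem hx, id, EuclideanSpace.norm_eq]
    refine Real.sqrt_le_sqrt ?_
    calc ∑ i, ‖x i‖ ^ 2 ≤ ∑ _i : Fin d, (1 : ℝ) := Finset.sum_le_sum fun i _ => by
          have : ‖x i‖ ≤ 1 := abs_le.2 (hx i)
          exact pow_le_one₀ (norm_nonneg _) this
      _ = d := by simp
  · simp [indicator_of_notMem hx]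

/-- A family of measurable functions of a linear predictor, indexed by the bit, is jointly
measurable. -/
theorem measurable_comp_inner {F : Type*} [MeasurableSpace F] {ψ : Bool → ℝ → F}
    (hψ : ∀ z, Measurable (ψ z)) (β : EuclideanSpace ℝ (Fin d)) :
    Measurable fun w : EuclideanSpace ℝ (Fin d) × Bool => ψ w.2 (inner ℝ β w.1) := by
  refine measurable_from_prod_countable_left fun z => ?_
  have : Measurable fun x : EuclideanSpace ℝ (Fin d) => (inner ℝ β x : ℝ) := by fun_prop
  exact (hψ z).comp this

theorem logDensity_eq (β : EuclideanSpace ℝ (Fin d)) (w : EuclideanSpace ℝ (Fin d) × Bool) :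
    logDensity m β w = Real.log (responseProb m w.2 (inner ℝ β w.1) * designDensity d w.1) := by
  rw [logDensity, releaseProb_modelLaw]

theorem measurable_logDensity (β : EuclideanSpace ℝ (Fin d)) : Measurable (logDensity m β) := by
  have hd : Measurable (designDensity d) :=
    Measurable.ite measurableSet_cube measurable_const measurable_const
  rw [funext (logDensity_eq m β)]
  exact ((measurable_comp_inner (fun z => (isBoundedLipschitz_responseProb m z).continuous.measurable)
    β).mul (hd.comp measurable_fst)).log

theorem exists_abs_logDensity_le (d : ℕ) :
    ∃ C, ∀ (β : EuclideanSpace ℝ (Fin d)) w, |logDensity m β w| ≤ C := by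
  obtain ⟨a, ha, b, hab⟩ := exists_le_responseProb_le m
  refine ⟨|Real.log (a * (1 / 2) ^ d)| + |Real.log (b * (1 / 2) ^ d)|, fun β w => ?_⟩
  rw [logDensity_eq, designDensity]
  split_ifs
  · obtain ⟨h1, h2⟩ := hab w.2 (inner ℝ β w.1)
    have hl := Real.log_le_log (x := a * (1 / 2) ^ d) (by positivity)
      (mul_le_mul_of_nonneg_right h1 (by positivity))
    have hu := Real.log_le_log (y := b * (1 / 2) ^ d)
      (mul_pos (responseProb_pos m w.2 (inner ℝ β w.1)) (by positivity))
      (mul_le_mul_of_nonneg_right h2 (by positivity))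
    rw [abs_le]
    constructor
    · linarith [neg_abs_le (Real.log (a * (1 / 2) ^ d)), abs_nonneg (Real.log (b * (1 / 2) ^ d))]
    · linarith [le_abs_self (Real.log (b * (1 / 2) ^ d)), abs_nonneg (Real.log (a * (1 / 2) ^ d))]
  · simp; positivity

theorem hasFDerivAt_inner_left (β x : EuclideanSpace ℝ (Fin d)) :
    HasFDerivAt (fun b => (inner ℝ b x : ℝ)) (innerSL ℝ x) β := by
  have heq : (fun b => (inner ℝ b x : ℝ)) = innerSL ℝ x := by
    ext b
    rw [innerSL_apply_apply, real_inner_comm]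
  rw [heq]
  exact (innerSL ℝ x).hasFDerivAt

theorem hasFDerivAt_logDensity (β : EuclideanSpace ℝ (Fin d))
    (w : EuclideanSpace ℝ (Fin d) × Bool) :
    HasFDerivAt (fun b => logDensity m b w) (innerSL ℝ (score m β w)) β := by
  simp only [logDensity_eq, score, cubeCovariate]
  by_cases hw : w.1 ∈ cube d
  · rw [indicator_of_mem hw, designDensity, if_pos hw]
    have := (hasDerivAt_log_responseProb_mul m w.2 (inner ℝ β w.1) (c := (1 / 2) ^ d)
      (by positivity)).comp_hasFDerivAt β (hasFDerivAt_inner_left β w.1)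
    exact this.congr_fderiv (by simp)
  · rw [indicator_of_notMem hw, designDensity, if_neg hw]
    simpa using hasFDerivAt_const (0 : ℝ) β

theorem hasFDerivAt_score (β : EuclideanSpace ℝ (Fin d)) (w : EuclideanSpace ℝ (Fin d) × Bool) :
    HasFDerivAt (fun b => score m b w) (scoreDeriv m β w) β := by
  simp only [score, scoreDeriv, cubeCovariate]
  by_cases hw : w.1 ∈ cube d
  · rw [indicator_of_mem hw]
    have := ((hasDerivAt_logResponseDeriv m w.2 (inner ℝ β w.1)).comp_hasFDerivAt β
      (hasFDerivAt_inner_left β w.1)).smul_const w.1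
    refine this.congr_fderiv ?_
    ext v i
    simp [mul_assoc]
  · rw [indicator_of_notMem hw]
    simpa using hasFDerivAt_const (0 : EuclideanSpace ℝ (Fin d)) β

/-- The Hessian is symmetric. -/
theorem inner_scoreDeriv_comm (β : EuclideanSpace ℝ (Fin d))
    (w : EuclideanSpace ℝ (Fin d) × Bool) (u v : EuclideanSpace ℝ (Fin d)) :
    inner ℝ (scoreDeriv m β w u) v = inner ℝ u (scoreDeriv m β w v) := by
  simp only [scoreDeriv, smul_apply, ContinuousLinearMap.smulRight_apply, innerSL_apply_apply,
    real_inner_smul_left, real_inner_smul_right, real_inner_comm u]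
  ring

/-- The log-likelihood of a single observation is a smooth criterion, whatever the true law of the
data: the bounds come from the model alone. -/
theorem exists_isSmoothCriterion_logDensity (μ : Measure (EuclideanSpace ℝ (Fin d) × Bool))
    [IsFiniteMeasure μ] :
    ∃ L, IsSmoothCriterion μ (logDensity m) (score m) (scoreDeriv m) L := by
  have huniform {ψ : Bool → ℝ → ℝ} (hψ : ∀ z, IsBoundedLipschitz (ψ z)) :
      ∃ C, (∀ z θ, |ψ z θ| ≤ C) ∧ ∀ z x y, |ψ z x - ψ z y| ≤ C * |x - y| := by
    choose C hC hC' using hψ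
    refine ⟨max (C true) (C false), fun z θ => (hC z θ).trans ?_, fun z x y =>
      (hC' z x y).trans (mul_le_mul_of_nonneg_right ?_ (abs_nonneg _))⟩ <;> cases z <;> simp
  obtain ⟨C₁, hC₁, -⟩ := huniform (isBoundedLipschitz_logResponseDeriv m)
  obtain ⟨C₂, hC₂, hC₂'⟩ := huniform (isBoundedLipschitz_logResponseDeriv₂ m)
  obtain ⟨C₀, hC₀⟩ := exists_abs_logDensity_le m d
  have hC₁nn : 0 ≤ C₁ := (abs_nonneg _).trans (hC₁ true 0)
  have hC₂nn : 0 ≤ C₂ := (abs_nonneg _).trans (hC₂ true 0)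
  have hχ (x : EuclideanSpace ℝ (Fin d)) :
      ‖(innerSL ℝ (cubeCovariate x)).smulRight (cubeCovariate x)‖ ≤ √d * √d := by
    rw [ContinuousLinearMap.norm_smulRight_apply, innerSL_apply_norm]
    gcongr <;> exact norm_cubeCovariate_le x
  have hcont : Continuous fun v : EuclideanSpace ℝ (Fin d) => (innerSL ℝ v).smulRight v := by
    fun_prop
  refine ⟨max (C₁ * √d) (max (C₂ * (√d * √d)) (C₂ * √d * (√d * √d))), ?_⟩
  exact
  { measurable_criterion := measurable_logDensity m
    measurable_score := fun β => (measurable_comp_inner (fun z =>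
      (isBoundedLipschitz_logResponseDeriv m z).continuous.measurable) β).smul
        (measurable_cubeCovariate.comp measurable_fst)
    stronglyMeasurable_hessian := fun β => (measurable_comp_inner (fun z =>
      (isBoundedLipschitz_logResponseDeriv₂ m z).continuous.measurable) β).stronglyMeasurable.smul
        (hcont.comp_stronglyMeasurable
          (measurable_cubeCovariate.comp measurable_fst).stronglyMeasurable)
    integrable_criterion := fun β => .of_bound (measurable_logDensity m β).aestronglyMeasurable C₀
      (ae_of_all _ (hC₀ β))
    hasFDerivAt_criterion := hasFDerivAt_logDensity m
    hasFDerivAt_score := hasFDerivAt_score m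
    norm_score_le := fun β w => by
      refine le_max_of_le_left ?_
      rw [score, norm_smul]
      gcongr
      exacts [hC₁ _ _, norm_cubeCovariate_le _]
    norm_hessian_le := fun β w => by
      refine le_max_of_le_right (le_max_of_le_left ?_)
      rw [scoreDeriv, norm_smul]
      gcongr
      exacts [hC₂ _ _, hχ _]
    norm_hessian_sub_le := fun β b w => by
      have hsub : scoreDeriv m b w - scoreDeriv m β w =
          (logResponseDeriv₂ m w.2 (inner ℝ b w.1) - logResponseDeriv₂ m w.2 (inner ℝ β w.1)) •
            (innerSL ℝ (cubeCovariate w.1)).smulRight (cubeCovariate w.1) := by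
        ext v i
        simp [scoreDeriv, sub_mul]
      rw [hsub, norm_smul]
      by_cases hw : w.1 ∈ cube d
      · have hx : ‖w.1‖ ≤ √d := by
          simpa [cubeCovariate, indicator_of_mem hw] using norm_cubeCovariate_le w.1
        have hinner : |(inner ℝ b w.1 : ℝ) - inner ℝ β w.1| ≤ ‖b - β‖ * √d := by
          rw [← inner_sub_left]
          exact (abs_real_inner_le_norm _ _).trans (by gcongr)
        calc _ ≤ C₂ * (‖b - β‖ * √d) * (√d * √d) := by
              gcongr
              exacts [(hC₂' _ _ _).trans (by gcongr), hχ _]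
          _ = C₂ * √d * (√d * √d) * ‖b - β‖ := by ring
          _ ≤ _ := by
              gcongr
              exact (le_max_right _ _).trans (le_max_right _ _)
      · simp only [cubeCovariate, indicator_of_notMem hw]
        simp
        positivity }

theorem partialDeriv_logDensity (β : EuclideanSpace ℝ (Fin d))
    (w : EuclideanSpace ℝ (Fin d) × Bool) (j : Fin d) :
    partialDeriv j (fun b => logDensity m b w) β = score m β w j := by
  rw [partialDeriv, ((hasFDerivAt_logDensity m β w).hasLineDerivAt _).lineDeriv,
    innerSL_apply_apply, EuclideanSpace.inner_single_right]
  simp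

theorem partialDeriv_partialDeriv_logDensity (β : EuclideanSpace ℝ (Fin d))
    (w : EuclideanSpace ℝ (Fin d) × Bool) (i j : Fin d) :
    partialDeriv i (partialDeriv j fun b => logDensity m b w) β =
      inner ℝ (scoreDeriv m β w (EuclideanSpace.single i 1)) (EuclideanSpace.single j 1) := by
  rw [funext fun b => partialDeriv_logDensity m b w j, partialDeriv]
  have := (EuclideanSpace.proj j : EuclideanSpace ℝ (Fin d) →L[ℝ] ℝ).hasFDerivAt.comp β
    (hasFDerivAt_score m β w)
  refine (this.hasLineDerivAt (EuclideanSpace.single i 1)).lineDeriv.trans ?_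
  rw [EuclideanSpace.inner_single_right]
  simp

end Criterion

end LDPQuantile

theorem mainTheorem5 (m : LDPQuantile.Survey) (d : ℕ)
    -- the true conditional law of `Y` given `X = x`, with a measurable density for every `x`
    (κ : Kernel (EuclideanSpace ℝ (Fin d)) ℝ) [IsMarkovKernel κ]
    (ν : Measure ℝ) (f : EuclideanSpace ℝ (Fin d) → ℝ → ℝ≥0∞)
    (hf_meas : ∀ x ∈ LDPQuantile.cube d, Measurable (f x))
    (hf_density : ∀ x ∈ LDPQuantile.cube d, κ x = ν.withDensity (f x))
    -- the compact parameter set and the unique, interior, maximizer `βs` of `P log p_β` over it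
    (𝓑 : Set (EuclideanSpace ℝ (Fin d))) (h𝓑 : IsCompact 𝓑)
    (βs : EuclideanSpace ℝ (Fin d)) (hβs_int : βs ∈ interior 𝓑)
    (hβs_max : IsMaxOn (LDPQuantile.expectedLogDensity m κ) 𝓑 βs)
    (hβs_unique : ∀ β ∈ 𝓑, IsMaxOn (LDPQuantile.expectedLogDensity m κ) 𝓑 β → β = βs)
    -- independent users following the protocol
    {Ω : Type*} [MeasurableSpace Ω] (P : Measure Ω) [IsProbabilityMeasure P]
    (X : ℕ → Ω → EuclideanSpace ℝ (Fin d)) (Y : ℕ → Ω → ℝ) (Z : ℕ → Ω → Bool)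
    (hlaw : ∀ i, HasLaw (fun ω => ((X i ω, Y i ω), Z i ω)) (LDPQuantile.userLaw m κ) P)
    (hindep : iIndepFun (fun i ω => ((X i ω, Y i ω), Z i ω)) P)
    -- the quasi-maximum likelihood estimators, computed from the `(X i, Z i)` only
    (βhat : ℕ → Ω → EuclideanSpace ℝ (Fin d)) (hβhat_meas : ∀ n, AEMeasurable (βhat n) P)
    (hβhat : ∀ n, ∀ᵐ ω ∂P, βhat n ω ∈ 𝓑 ∧
      IsMaxOn (LDPQuantile.logLikelihood m n fun i => (X i ω, Z i ω)) 𝓑 (βhat n ω)) :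
    (∀ᵐ ω ∂P, Tendsto (fun n => βhat n ω) atTop (𝓝 βs)) ∧
    (IsUnit (LDPQuantile.hessianMatrix m κ βs) →
      TendstoInDistribution (fun (n : ℕ) ω => √(n : ℝ) • (βhat n ω - βs)) atTop id (fun _ => P)
        (multivariateGaussian 0 (LDPQuantile.asymptoticCov m κ βs))) := by
  -- the curator's view of the data is i.i.d. with law `observedLaw m κ`
  have hview : Measurable fun w : (EuclideanSpace ℝ (Fin d) × ℝ) × Bool => (w.1.1, w.2) := by
    fun_prop
  have hobs (i : ℕ) : HasLaw (fun ω => (X i ω, Z i ω)) (LDPQuantile.observedLaw m κ) P :=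
    HasLaw.fun_comp (Y := fun w : (EuclideanSpace ℝ (Fin d) × ℝ) × Bool => (w.1.1, w.2))
      ⟨hview.aemeasurable, rfl⟩ (hlaw i)
  have hobs_indep : iIndepFun (fun i ω => (X i ω, Z i ω)) P :=
    hindep.comp (fun _ w => (w.1.1, w.2)) fun _ => hview
  have : IsProbabilityMeasure (LDPQuantile.observedLaw m κ) :=
    (hobs 0).isProbabilityMeasure_iff.1 inferInstance
  obtain ⟨L, hL⟩ := LDPQuantile.exists_isSmoothCriterion_logDensity m (LDPQuantile.observedLaw m κ)
  have hcons := hL.ae_tendsto_argmax hobs hobs_indep h𝓑 hβs_unique hβhat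
  refine ⟨hcons, fun hunit => ?_⟩
  exact hL.tendstoInDistribution_argmax hobs hobs_indep
    (fun w => LDPQuantile.inner_scoreDeriv_comm m βs w) hβs_int hβs_max hβhat_meas hβhat hcons
    (fun i j => by
      simp only [LDPQuantile.hessianMatrix, Matrix.of_apply,
        LDPQuantile.partialDeriv_partialDeriv_logDensity])
    (fun i j => by
      simp only [LDPQuantile.scoreMatrix, Matrix.of_apply, LDPQuantile.partialDeriv_logDensity])
    hunit
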